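/- **Conventions.** Let $M$ be a smooth (Hausdorff) manifold of dimension $n$. An operator field on an open set $U\subseteq M$ is a smooth field $L$ of linear operators on the tangent spaces $T_xM$, $x\in U$. For vector fields $X,Y$ put $$\mathcal T_L(X,Y)=L^2[X,Y]+[LX,LY]-L\big([X,LY]+[LX,Y]\big),$$ $$\mathcal H_L(X,Y)=L^2\mathcal T_L(X,Y)+\mathcal T_L(LX,LY)-L\big(\mathcal T_L(X,LY)+\mathcal T_L(LX,Y)\big).$$ $L$ is a Nijenhuis (Haantjes) operator if $\mathcal T_L$ ($\mathcal H_L$) vanishes identically. $L$ is semisimple if around each point there is a smooth local frame of eigenvector fields of $L$. A Haantjes algebra with identity of rank $m$ on $U$ is a set $\mathscr H$ of Haantjes operators on $U$ that contains the identity $I$, is closed under $C^\infty(U)$-linear combinations and under composition, and is a free $C^\infty(U)$-module of rank $m$; it is Abelian if its elements commute, and semisimple if all its elements are semisimple. A cyclic generator of $\mathscr H$ is a Haantjes operator $L$ whose minimal polynomial has degree $m$ at every point and for which $\mathscr H$ is the set of all $C^\infty(U)$-linear combinations of $I,L,L^2,\dots$; $\mathscr H$ is cyclic if it has a cyclic generator.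 For $V\subseteq U$ open, $\mathscr H|_V$ denotes the algebra generated over $C^\infty(V)$ by the restrictions to $V$ of the elements of $\mathscr H$. **Proposition.** Let $\mathscr H$ be a semisimple Abelian Haantjes algebra with identity, of rank $m$, on $M$. Let $K_1,\dots,K_m$ be a basis of $\mathscr H$ such that the eigenvalues of each $K_k$ are real smooth functions $l^{(k)}_1,\dots,l^{(k)}_{s_k}$ on $M$ that are pairwise distinct at every point. Consider the joint spectral decomposition $$T_xM=\bigoplus_{i_1,\dots,i_m}\ \bigcap_{k=1}^m\ker\big(K_k-l^{(k)}_{i_k}I\big)(x)=\bigoplus_{a=1}^v\mathcal V_a(x),$$ where $\mathcal V_1,\dots,\mathcal V_v$ are the addends that do not vanish identically on $M$, and suppose that $v\le m$. Then: 1. $\mathscr H$ is cyclic. 2. Let $(U,(y^1,\dots,y^n))$ be a chart of $M$ whose coordinates are grouped into $m$ nonempty blocks $(y^{a,1},\dots,y^{a,r_a})$, $a=1,\dots,m$, and which is adapted to the decomposition or (if $v<m$) to a finer one, i.e. for each $a$ the vector fields $\partial/\partial y^{a,1},\dots,\partial/\partial y^{a,r_a}$ all lie in a single $\mathcal V_{c(a)}$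 on $U$. Let $\lambda_1,\dots,\lambda_m\in C^\infty(U)$ be pairwise distinct at every point of $U$. Then $$L=\sum_{a=1}^m\lambda_a\sum_{j=1}^{r_a}\frac{\partial}{\partial y^{a,j}}\otimes dy^{a,j}$$ is a cyclic generator of $\mathscr H|_U$. 3. If, in addition, each $\lambda_a$ depends only on the coordinates $y^{a,1},\dots,y^{a,r_a}$ of its own block, then $L$ is moreover a Nijenhuis operator. -/

import Mathlib

open scoped Manifold ContDiff
open TopologicalSpace

namespace Haantjes

/-- The model space `ℝⁿ`. -/
abbrev Model (n : ℕ) : Type := EuclideanSpace ℝ (Fin n)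

section Fields

variable (n : ℕ) {M : Type*} [TopologicalSpace M] [ChartedSpace (Model n) M]

/-- Tangent space at a point of the `n`-dimensional manifold `M`. -/
abbrev Tan (x : M) : Type := TangentSpace 𝓘(ℝ, Model n) x

/-- The ring `C^∞(U)` of smooth real functions on an open subset `U` of `M`. -/
abbrev SmoothFun (U : Opens M) : Type _ :=
  ContMDiffMap 𝓘(ℝ, Model n) 𝓘(ℝ, ℝ) U ℝ ∞

/-- Fields of linear operators on the tangent spaces at the points of the open set `U`
(smoothness is the separate predicate `OpField.IsSmooth`). -/
def OpField (U : Opens M) : Type _ :=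
  (x : U) → (Tan n (x : M) →L[ℝ] Tan n (x : M))

/-- Pointwise sum; the product is the pointwise composition; `1` is the identity operator. -/
noncomputable instance (U : Opens M) : Ring (OpField n U) :=
  inferInstanceAs (Ring ((x : U) → (Tan n (x : M) →L[ℝ] Tan n (x : M))))

/-- Operator fields on `U` form an algebra over `C^∞(U)`, with `(f • K)(x) = f(x) K(x)`. -/
noncomputable instance (U : Opens M) : Algebra (SmoothFun n U) (OpField n U) where
  smul f K := fun x => f x • K x
  algebraMap :=
    { toFun := fun f x => f x • ContinuousLinearMap.id ℝ (Tan n (x : M))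
      map_one' := by
        funext x; exact one_smul ℝ (ContinuousLinearMap.id ℝ (Tan n (x : M)))
      map_mul' := by
        intro f g; funext x
        apply ContinuousLinearMap.ext; intro w
        exact mul_smul (f x) (g x) w
      map_zero' := by
        funext x; exact zero_smul ℝ (ContinuousLinearMap.id ℝ (Tan n (x : M)))
      map_add' := by
        intro f g; funext x
        exact add_smul (f x) (g x) (ContinuousLinearMap.id ℝ (Tan n (x : M))) }
  commutes' := by
    intro f K; funext x
    apply ContinuousLinearMap.ext; intro w
    exact ((K x).map_smul (f x) w).symm
  smul_def' := by
    intro f K; funext x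
    apply ContinuousLinearMap.ext; intro w
    rfl

/-- The vector field `X` is smooth on the set `s`. -/
def SmoothVectorFieldOn [IsManifold 𝓘(ℝ, Model n) ∞ M] (s : Set M) (X : (x : M) → Tan n x) : Prop :=
  ContMDiffOn 𝓘(ℝ, Model n) (𝓘(ℝ, Model n)).tangent ∞
    (fun x => (⟨x, X x⟩ : TangentBundle 𝓘(ℝ, Model n) M)) s

/-- Nijenhuis torsion
`T_L(X,Y) = L²[X,Y] + [LX,LY] - L([X,LY] + [LX,Y])`. -/
noncomputable def nijenhuisTorsion (L : (x : M) → (Tan n x →L[ℝ] Tan n x))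
    (X Y : (x : M) → Tan n x) (x : M) : Tan n x :=
  L x (L x (VectorField.mlieBracket 𝓘(ℝ, Model n) X Y x))
    + VectorField.mlieBracket 𝓘(ℝ, Model n) (fun y => L y (X y)) (fun y => L y (Y y)) x
    - L x (VectorField.mlieBracket 𝓘(ℝ, Model n) X (fun y => L y (Y y)) x
        + VectorField.mlieBracket 𝓘(ℝ, Model n) (fun y => L y (X y)) Y x)

/-- Haantjes torsion
`H_L(X,Y) = L² T_L(X,Y) + T_L(LX,LY) - L(T_L(X,LY) + T_L(LX,Y))`. -/
noncomputable def haantjesTorsion (L : (x : M) → (Tan n x →L[ℝ] Tan n x))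
    (X Y : (x : M) → Tan n x) (x : M) : Tan n x :=
  L x (L x (nijenhuisTorsion n L X Y x))
    + nijenhuisTorsion n L (fun y => L y (X y)) (fun y => L y (Y y)) x
    - L x (nijenhuisTorsion n L X (fun y => L y (Y y)) x
        + nijenhuisTorsion n L (fun y => L y (X y)) Y x)

end Fields

namespace OpField

variable {n : ℕ} {M : Type*} [TopologicalSpace M] [ChartedSpace (Model n) M]
  [IsManifold 𝓘(ℝ, Model n) ∞ M]

open Classical in
/-- Extension of an operator field on `U` by zero outside `U`. It only serves to evaluate local
operations (smoothness on `U`, Lie brackets at points of `U`), which do not see the extension. -/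
noncomputable def ext {U : Opens M} (K : OpField n U) (x : M) : Tan n x →L[ℝ] Tan n x :=
  if h : x ∈ U then K ⟨x, h⟩ else 0

/-- Restriction of an operator field to a smaller open set. -/
def res {U V : Opens M} (h : V ≤ U) (K : OpField n U) : OpField n V :=
  fun x => K ⟨x, h x.2⟩

/-- `K` is a Nijenhuis operator on `U`: its Nijenhuis torsion vanishes identically. -/
def IsNijenhuis {U : Opens M} (K : OpField n U) : Prop :=
  ∀ X Y : (x : M) → Tan n x,
    SmoothVectorFieldOn n (U : Set M) X → SmoothVectorFieldOn n (U : Set M) Y →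
      ∀ x ∈ U, nijenhuisTorsion n K.ext X Y x = 0

/-- `K` is a Haantjes operator on `U`: its Haantjes torsion vanishes identically. -/
def IsHaantjes {U : Opens M} (K : OpField n U) : Prop :=
  ∀ X Y : (x : M) → Tan n x,
    SmoothVectorFieldOn n (U : Set M) X → SmoothVectorFieldOn n (U : Set M) Y →
      ∀ x ∈ U, haantjesTorsion n K.ext X Y x = 0

/-- `K` is semisimple: around each point there is a smooth local frame of eigenvector fields. -/
def IsSemisimple {U : Opens M} (K : OpField n U) : Prop :=
  ∀ x ∈ U, ∃ W : Opens M, x ∈ W ∧ W ≤ U ∧ ∃ Y : Fin n → (y : M) → Tan n y,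
    (∀ i, SmoothVectorFieldOn n (W : Set M) (Y i)) ∧
    ∀ y ∈ W, LinearIndependent ℝ (fun i => Y i y) ∧
      ∀ i, ∃ c : ℝ, K.ext y (Y i y) = c • Y i y

/-- `K` is a smooth section over `U` of the bundle of endomorphisms of the tangent bundle. -/
def IsSmooth {U : Opens M} (K : OpField n U) : Prop :=
  ContMDiffOn 𝓘(ℝ, Model n) (𝓘(ℝ, Model n).prod 𝓘(ℝ, Model n →L[ℝ] Model n)) ∞
    (fun x => Bundle.TotalSpace.mk' (Model n →L[ℝ] Model n)
      (E := fun y : M => Tan n y →L[ℝ] Tan n y) x (K.ext x)) (U : Set M)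

end OpField

section Algebras

variable {n : ℕ} {M : Type*} [TopologicalSpace M] [ChartedSpace (Model n) M]
  [IsManifold 𝓘(ℝ, Model n) ∞ M]

/-- `H` (a subalgebra over `C^∞(U)`: closed under `C^∞(U)`-linear combinations and composition,
and containing the identity) is a Haantjes algebra with identity of rank `m` on `U`: it consists
of smooth Haantjes operators and is a free `C^∞(U)`-module with a basis of `m` elements. -/
structure IsHaantjesAlgebra {U : Opens M} (H : Subalgebra (SmoothFun n U) (OpField n U))
    (m : ℕ) : Prop where
  smooth : ∀ K ∈ H, K.IsSmooth
  haantjes : ∀ K ∈ H, K.IsHaantjes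
  free : Nonempty (Module.Basis (Fin m) (SmoothFun n U) H)

/-- The algebra is semisimple: each of its operators is. -/
def IsSemisimpleAlgebra {U : Opens M} (H : Subalgebra (SmoothFun n U) (OpField n U)) : Prop :=
  ∀ K ∈ H, K.IsSemisimple

/-- The algebra is Abelian. -/
def IsAbelianAlgebra {U : Opens M} (H : Subalgebra (SmoothFun n U) (OpField n U)) : Prop :=
  ∀ K ∈ H, ∀ L ∈ H, K * L = L * K

/-- The algebra induced by `H` on a smaller open set `V`: generated over `C^∞(V)` by the
restrictions to `V` of the operators of `H`. -/
noncomputable def restrictAlgebra {U V : Opens M} (h : V ≤ U)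
    (H : Subalgebra (SmoothFun n U) (OpField n U)) :
    Subalgebra (SmoothFun n V) (OpField n V) :=
  Algebra.adjoin (SmoothFun n V) (OpField.res h '' (H : Set (OpField n U)))

/-- `L` is a cyclic generator of the rank `m` algebra `H`: a smooth Haantjes operator whose minimal
polynomial has degree `m` (at each point), such that `H` is the algebra of all `C^∞(U)`-linear
combinations of `I, L, L², …`. -/
structure IsCyclicGenerator {U : Opens M} (H : Subalgebra (SmoothFun n U) (OpField n U))
    (m : ℕ) (L : OpField n U) : Prop where
  smooth : L.IsSmooth
  haantjes : L.IsHaantjes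
  minpoly_degree : ∀ x : U, (minpoly ℝ (L x)).natDegree = m
  generates : H = Algebra.adjoin (SmoothFun n U) {L}

/-- `H`, of rank `m`, is cyclic. -/
def IsCyclicHaantjesAlgebra {U : Opens M} (H : Subalgebra (SmoothFun n U) (OpField n U)) (m : ℕ) : Prop :=
  ∃ L : OpField n U, IsCyclicGenerator H m L

end Algebras

section Spectral

variable {n : ℕ} {M : Type*} [TopologicalSpace M] [ChartedSpace (Model n) M]

/-- `l 0, …, l (s-1)` are the eigenvalues of `K`, all real: they are smooth functions, pairwise
distinct at every point, and at every point they are exactly the eigenvalues of `K`. -/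
def HasDistinctSpectrum {U : Opens M} (K : OpField n U) {s : ℕ}
    (l : Fin s → SmoothFun n U) : Prop :=
  ∀ x : U, Function.Injective (fun i => l i x) ∧
    ∀ μ : ℝ, Module.End.HasEigenvalue (K x).toLinearMap μ ↔ ∃ i, μ = l i x

/-- The eigen-distribution `ker (K - l I)` at the point `x`. -/
noncomputable def eigenDistribution {U : Opens M} (K : OpField n U) (l : SmoothFun n U) (x : U) :
    Submodule ℝ (Tan n (x : M)) :=
  Module.End.eigenspace (K x).toLinearMap (l x)

/-- The addend `D⁽¹⁾_{i₁} ∩ … ∩ D⁽ᵐ⁾_{iₘ}` at `x` of the joint spectral decomposition of the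
operators `K₁, …, Kₘ` with eigenvalues `l k i`. -/
noncomputable def jointAddend {U : Opens M} {m : ℕ} (K : Fin m → OpField n U) {s : Fin m → ℕ}
    (l : (k : Fin m) → Fin (s k) → SmoothFun n U) (i : (k : Fin m) → Fin (s k)) (x : U) :
    Submodule ℝ (Tan n (x : M)) :=
  ⨅ k, eigenDistribution (K k) (l k (i k)) x

/-- The number `v` of nontrivial addends of the joint spectral decomposition. -/
noncomputable def numAddends {U : Opens M} {m : ℕ} (K : Fin m → OpField n U) {s : Fin m → ℕ}
    (l : (k : Fin m) → Fin (s k) → SmoothFun n U) : ℕ :=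
  Nat.card {i : (k : Fin m) → Fin (s k) // ∃ x : U, jointAddend K l i x ≠ ⊥}

end Spectral

section Charts

variable {n : ℕ} {M : Type*} [TopologicalSpace M] [ChartedSpace (Model n) M]

/-- The domain of a chart. -/
def chartDomain (e : OpenPartialHomeomorph M (Model n)) : Opens M := ⟨e.source, e.open_source⟩

/-- The vector field `∂/∂yⁱ` of the natural frame of the chart `e = (y¹, …, yⁿ)`. -/
noncomputable def coordField (e : OpenPartialHomeomorph M (Model n)) (i : Fin n) (x : M) :
    Tan n x :=
  VectorField.mpullback 𝓘(ℝ, Model n) 𝓘(ℝ, Model n) e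
    (fun _ => (EuclideanSpace.single i (1 : ℝ) : Model n)) x

/-- The differential `dyⁱ` of the `i`-th coordinate function of `e`. -/
noncomputable def coordForm (e : OpenPartialHomeomorph M (Model n)) (i : Fin n) (x : M) :
    Tan n x →L[ℝ] ℝ :=
  (EuclideanSpace.proj i : Model n →L[ℝ] ℝ).comp
    (mfderiv 𝓘(ℝ, Model n) 𝓘(ℝ, Model n) e x : Tan n x →L[ℝ] Model n)

/-- The distribution spanned by the coordinate fields of the `a`-th block of coordinates. The
coordinates are grouped into `m` blocks by `b`: the coordinates of block `a` are the `yⁱ` with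
`b i = a`. -/
noncomputable def blockDistribution (e : OpenPartialHomeomorph M (Model n)) {m : ℕ}
    (b : Fin n → Fin m) (a : Fin m) (x : M) : Submodule ℝ (Tan n x) :=
  Submodule.span ℝ {w | ∃ i, b i = a ∧ w = coordField e i x}

/-- The chart `e`, with its coordinates grouped into `m` nonempty blocks, is adapted to the joint
spectral decomposition of `K`, or to a finer one with `m` addends: each block of coordinate fields
spans a subspace of a single addend. (If the number of addends is `m`, the blocks then
span exactly the addends.) -/
def IsAdaptedChart {U : Opens M} {m : ℕ} (K : Fin m → OpField n U) {s : Fin m → ℕ}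
    (l : (k : Fin m) → Fin (s k) → SmoothFun n U) (e : OpenPartialHomeomorph M (Model n))
    (h : chartDomain e ≤ U) (b : Fin n → Fin m) : Prop :=
  Function.Surjective b ∧ ∀ a : Fin m, ∃ i : (k : Fin m) → Fin (s k),
    ∀ x : chartDomain e, blockDistribution e b a (x : M) ≤ jointAddend K l i ⟨x, h x.2⟩

/-- The operator `L = ∑ₐ λₐ ∑ⱼ ∂/∂y^{a,j} ⊗ dy^{a,j}` on the domain of the chart `e`. -/
noncomputable def diagonalOperator (e : OpenPartialHomeomorph M (Model n)) {m : ℕ}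
    (b : Fin n → Fin m) (lam : Fin m → SmoothFun n (chartDomain e)) :
    OpField n (chartDomain e) :=
  fun x => ∑ a, lam a x • ∑ i with b i = a,
    (coordForm e i (x : M)).smulRight (coordField e i (x : M))

end Charts

end Haantjes

open Haantjes

/-! Everything reduces to the projections `π i` onto the joint eigenspaces. Eigenvalues that are
distinct at every point have invertible differences in `C^∞`, so Lagrange interpolation with smooth
coefficients writes each projection as a polynomial in the `K k`; hence the `π i` lie in `H`
(`exists_joint_projections`). They are complete orthogonal idempotents and span `H`, because each `K
k` is the sum of its eigenvalues times the `π i`.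

The crux is `exists_complete_projections`. Expressing `K` in `π` and `π` in `K` gives matrices `A`,
`B` with `A * B = 1`, since `K` is a basis. Ranks at one point give `m ≤ v`, so `v = m` and `B * A =
1`. No `π i` vanishes at a point, even if `M` is disconnected: the zero set of a smooth idempotent
is clopen, so its indicator is smooth, annihilates `π i`, and by freeness annihilates row `i` of
`B`; at a zero of `π i` this contradicts `(B * A) i i = 1`.

A combination of `m` nowhere vanishing idempotents with pointwise distinct coefficients has minimal
polynomial of degree `m` at each point, and interpolation recovers every idempotent from it, so it
generates (`isCyclicGenerator_sum`). Constant coefficients prove the first claim. In an adapted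
chart the blocks match the addends bijectively, so the diagonal operator is such a combination; its
torsions are computed in coordinates. -/

namespace Haantjes

/-! ### Polynomials in a combination of orthogonal idempotents -/

section Idempotents

open Polynomial

variable {R A ι : Type*} [CommRing R] [Ring A] [Algebra R A] [Fintype ι]

/-- Combinations of orthogonal idempotents multiply coefficientwise, and completeness spreads the
constants over all of them. -/
lemma aeval_sum_smul_idempotents {π : ι → A} (h : CompleteOrthogonalIdempotents π)
    (μ : ι → R) (p : R[X]) :
    aeval (∑ i, μ i • π i) p = ∑ i, p.eval (μ i) • π i := by
  classical
  have hmul : ∀ f g : ι → R,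
      (∑ i, f i • π i) * (∑ i, g i • π i) = ∑ i, (f i * g i) • π i := by
    intro f g
    simp only [Finset.sum_mul_sum, smul_mul_smul_comm, h.mul_eq, smul_ite, smul_zero,
      Finset.sum_ite_eq, Finset.mem_univ, if_true]
  have hC : ∀ c : R, algebraMap R A c = ∑ i, c • π i := by
    intro c
    rw [← Finset.smul_sum, h.complete, Algebra.algebraMap_eq_smul_one]
  induction p using Polynomial.induction_on with
  | C a => simp [hC]
  | add p q hp hq => simp [hp, hq, add_smul, Finset.sum_add_distrib]
  | monomial k a ih =>
    rw [pow_succ, ← mul_assoc, map_mul, ih, aeval_X, hmul]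
    simp only [eval_mul, eval_X]

/-- Over a ring the Lagrange denominators must be units; being nonzero does not suffice. -/
lemma exists_lagrange_of_isUnit_sub (μ : ι → R)
    (hμ : ∀ i j, i ≠ j → IsUnit (μ i - μ j)) :
    ∃ p : ι → R[X], ∀ i, (p i).eval (μ i) = 1 ∧ ∀ j, j ≠ i → (p i).eval (μ j) = 0 := by
  classical
  refine ⟨fun i => ∏ j ∈ Finset.univ.erase i, C (Ring.inverse (μ i - μ j)) * (X - C (μ j)),
    fun i => ⟨?_, fun j hj => ?_⟩⟩
  · rw [eval_prod]
    refine Finset.prod_eq_one fun j hj => ?_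
    simp [Ring.inverse_mul_cancel _ (hμ i j (Finset.ne_of_mem_erase hj).symm)]
  · rw [eval_prod]
    exact Finset.prod_eq_zero (Finset.mem_erase.2 ⟨hj, Finset.mem_univ j⟩) (by simp)

lemma idempotent_mem_adjoin {π : ι → A} (h : CompleteOrthogonalIdempotents π) (μ : ι → R)
    (hμ : ∀ i j, i ≠ j → IsUnit (μ i - μ j)) (i : ι) :
    π i ∈ Algebra.adjoin R {∑ i, μ i • π i} := by
  obtain ⟨p, hp⟩ := exists_lagrange_of_isUnit_sub μ hμ
  have : aeval (∑ i, μ i • π i) (p i) = π i := by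
    rw [aeval_sum_smul_idempotents h, Finset.sum_eq_single i, (hp i).1, one_smul]
    · intro j _ hj
      rw [(hp i).2 j hj, zero_smul]
    · simp
  rw [← this]
  exact aeval_mem_adjoin_singleton R _

/-- Multiplying a polynomial relation by `π i` isolates the value of the polynomial at `μ i`; so the
annihilating polynomials vanish at all the `μ i`, and the product of the distinct factors `X - μ i`
is the minimal one. -/
lemma minpoly_natDegree_sum_idempotents {k B : Type*} [Field k] [Ring B] [Algebra k B]
    {π : ι → B} (h : CompleteOrthogonalIdempotents π) (h0 : ∀ i, π i ≠ 0) (μ : ι → k)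
    (hμ : Function.Injective μ) :
    (minpoly k (∑ i, μ i • π i)).natDegree = Fintype.card ι := by
  classical
  have key : ∀ q : k[X], aeval (∑ i, μ i • π i) q = 0 → ∀ i, q.eval (μ i) = 0 := by
    intro q hq i
    rw [aeval_sum_smul_idempotents h] at hq
    have := congrArg (· * π i) hq
    simpa [Finset.sum_mul, h.mul_eq, h0 i] using this
  have hroot : ∀ i, eval (μ i) (∏ i, (X - C (μ i))) = 0 := fun i => by
    rw [eval_prod]
    exact Finset.prod_eq_zero (Finset.mem_univ i) (by simp)
  have hmin : ∏ i, (X - C (μ i)) = minpoly k (∑ i, μ i • π i) := by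
    refine minpoly.unique k _ (monic_prod_of_monic _ _ fun i _ => monic_X_sub_C _) ?_ ?_
    · rw [aeval_sum_smul_idempotents h]
      exact Finset.sum_eq_zero fun i _ => by rw [hroot, zero_smul]
    · intro q hq hq0
      refine degree_le_of_dvd ?_ hq.ne_zero
      refine Finset.prod_dvd_of_coprime (fun i _ j _ hij => ?_) fun i _ => ?_
      · exact pairwise_coprime_X_sub_C hμ hij
      · exact dvd_iff_isRoot.2 (key q hq0 i)
  rw [← hmin, natDegree_prod_of_monic _ _ fun i _ => monic_X_sub_C _]
  simp

end Idempotents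

/-! ### Smooth functions and operator fields: units, evaluation, restriction -/

section Functions

variable {n : ℕ} {M : Type*} [TopologicalSpace M] [ChartedSpace (Model n) M]

lemma isUnit_of_forall_ne_zero {U : Opens M} (f : SmoothFun n U) (hf : ∀ x, f x ≠ 0) :
    IsUnit f := by
  refine IsUnit.of_mul_eq_one
    (⟨fun x => (f x)⁻¹, f.contMDiff.inv₀ hf⟩ : SmoothFun n U) ?_
  ext x
  exact mul_inv_cancel₀ (hf x)

lemma isUnit_sub_of_injective {ι : Type*} {U : Opens M} (μ : ι → SmoothFun n U)
    (hμ : ∀ x, Function.Injective fun i => μ i x) (i j : ι) (hij : i ≠ j) :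
    IsUnit (μ i - μ j) :=
  isUnit_of_forall_ne_zero _ fun x h => hij (hμ x (sub_eq_zero.1 h))

/-- Evaluation at a point, as a ring homomorphism. -/
noncomputable def evalAt {U : Opens M} (x : U) : SmoothFun n U →+* ℝ where
  toFun f := f x
  map_one' := rfl
  map_mul' _ _ := rfl
  map_zero' := rfl
  map_add' _ _ := rfl

/-- Restriction of smooth functions to a smaller open set. -/
noncomputable def resFun {U V : Opens M} (h : V ≤ U) : SmoothFun n U →+* SmoothFun n V where
  toFun f := ⟨fun x => f (Opens.inclusion h x), f.contMDiff.comp (contMDiff_inclusion h)⟩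
  map_one' := rfl
  map_mul' _ _ := rfl
  map_zero' := rfl
  map_add' _ _ := rfl

lemma contMDiffAt_of_smoothFun {U : Opens M} (f : SmoothFun n U) {g : M → ℝ}
    (hg : ∀ x : U, g x = f x) {x : M} (hx : x ∈ U) :
    ContMDiffAt 𝓘(ℝ, Model n) 𝓘(ℝ, ℝ) ∞ g x := by
  refine (contMDiffAt_subtype_iff (U := U) (x := ⟨x, hx⟩)).1 ?_
  have : (fun y : U => g y) = f := funext hg
  rw [this]
  exact f.contMDiff _

namespace OpField

lemma ext_apply {U : Opens M} (K : OpField n U) {x : M} (hx : x ∈ U) :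
    K.ext x = K ⟨x, hx⟩ := dif_pos hx

lemma smul_apply {U : Opens M} (f : SmoothFun n U) (K : OpField n U) (x : U) :
    (f • K) x = f x • K x := rfl

lemma mul_apply {U : Opens M} (K L : OpField n U) (x : U) (w : Tan n (x : M)) :
    (K * L) x w = K x (L x w) := rfl

/-- Evaluation of operator fields at a point, as a ring homomorphism. -/
def evalHom {U : Opens M} (x : U) : OpField n U →+* (Tan n (x : M) →L[ℝ] Tan n (x : M)) where
  toFun K := K x
  map_one' := rfl
  map_mul' _ _ := rfl
  map_zero' := rfl
  map_add' _ _ := rfl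

/-- Restriction of operator fields, as a ring homomorphism. -/
def resHom {U V : Opens M} (h : V ≤ U) : OpField n U →+* OpField n V where
  toFun K := K.res h
  map_one' := rfl
  map_mul' _ _ := rfl
  map_zero' := rfl
  map_add' _ _ := rfl

lemma sum_apply {ι : Type*} {U : Opens M} (s : Finset ι) (F : ι → OpField n U) (x : U) :
    (∑ i ∈ s, F i) x = ∑ i ∈ s, F i x :=
  map_sum (evalHom x) F s

/-- Although the coefficients are functions, the product is pointwise, so an eigenvector at the
single point `x` is enough. -/
lemma aeval_apply_eigenvector {U : Opens M} (K : OpField n U) (p : Polynomial (SmoothFun n U))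
    (μ : SmoothFun n U) (x : U) (w : Tan n (x : M)) (hw : K x w = μ x • w) :
    (Polynomial.aeval K p) x w = (p.eval μ) x • w := by
  induction p using Polynomial.induction_on with
  | C a =>
    rw [Polynomial.aeval_C, Polynomial.eval_C]; rfl
  | add p q hp hq =>
    rw [map_add, Polynomial.eval_add]
    exact (congrArg₂ (· + ·) hp hq).trans (add_smul _ _ _).symm
  | monomial k a ih =>
    rw [pow_succ, ← mul_assoc, map_mul, Polynomial.aeval_X, mul_apply, hw, map_smul, ih,
      Polynomial.eval_mul_X, smul_smul]
    congr 1
    exact mul_comm _ _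

end OpField

end Functions

/-! ### Pointwise diagonalizability -/

section Spectral

variable {n : ℕ} {M : Type*} [TopologicalSpace M] [ChartedSpace (Model n) M]

lemma iSup_eigenspace_eq_top [IsManifold 𝓘(ℝ, Model n) ∞ M] {U : Opens M} {K : OpField n U}
    (hK : K.IsSemisimple) (x : U) :
    ⨆ c : ℝ, Module.End.eigenspace (K x).toLinearMap c = ⊤ := by
  obtain ⟨W, hxW, -, Y, -, hY⟩ := hK x x.2
  obtain ⟨hli, hc⟩ := hY x hxW
  have : FiniteDimensional ℝ (Tan n (x : M)) :=
    inferInstanceAs (FiniteDimensional ℝ (Model n))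
  have hspan : Submodule.span ℝ (Set.range fun i => Y i x) = ⊤ := by
    refine hli.span_eq_top_of_card_eq_finrank' ?_
    rw [Fintype.card_fin]
    exact (finrank_euclideanSpace_fin (𝕜 := ℝ) (n := n)).symm
  rw [eq_top_iff, ← hspan, Submodule.span_le]
  rintro _ ⟨i, rfl⟩
  obtain ⟨c, hci⟩ := hc i
  refine Submodule.mem_iSup_of_mem c (Module.End.mem_eigenspace_iff.2 ?_)
  have : K.ext (x : M) = K x := dif_pos x.2
  rw [this] at hci
  exact hci

end Spectral

/-- The product of `X - μ` over the eigenvalues is squarefree and kills every eigenspace, so `f` is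
semisimple. This lets the simultaneous decomposition into generalized eigenspaces be read with
ordinary ones. -/
lemma maxGenEigenspace_eq_eigenspace_of_iSup_eq_top {V : Type*} [AddCommGroup V] [Module ℝ V]
    [FiniteDimensional ℝ V] (f : Module.End ℝ V) (hf : ⨆ c, f.eigenspace c = ⊤) (c : ℝ) :
    f.maxGenEigenspace c = f.eigenspace c := by
  classical
  refine Module.End.IsFinitelySemisimple.maxGenEigenspace_eq_eigenspace ?_ c
  refine Module.End.IsSemisimple.isFinitelySemisimple ?_
  have hfin : Set.Finite {μ | f.HasEigenvalue μ} := Module.End.finite_hasEigenvalue f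
  refine Module.End.isSemisimple_of_squarefree_aeval_eq_zero
    (p := ∏ μ ∈ hfin.toFinset, (Polynomial.X - Polynomial.C μ)) ?_ ?_
  · exact (Polynomial.separable_prod_X_sub_C_iff' (F := ℝ) (f := id).2
      (fun x _ y _ h => h)).squarefree
  · ext w
    have hw : w ∈ ⨆ c, f.eigenspace c := hf ▸ Submodule.mem_top
    induction hw using Submodule.iSup_induction' with
    | mem μ w hw =>
      by_cases h0 : w = 0
      · simp [h0]
      · rw [Module.End.aeval_apply_of_hasEigenvector ⟨hw, h0⟩, Polynomial.eval_prod,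
          Finset.prod_eq_zero (i := μ)]
        · simp
        · simpa using Module.End.hasEigenvalue_of_hasEigenvector ⟨hw, h0⟩
        · simp
    | zero => simp
    | add x y _ _ hx hy => simp [hx, hy]

/-! ### The joint spectral decomposition and its projections -/

section Joint

variable {n : ℕ} {M : Type*} [TopologicalSpace M] [ChartedSpace (Model n) M]

lemma iSup_jointAddend_eq_top [IsManifold 𝓘(ℝ, Model n) ∞ M] {U : Opens M} {m : ℕ}
    {K : Fin m → OpField n U} {s : Fin m → ℕ} {l : (k : Fin m) → Fin (s k) → SmoothFun n U}
    (hK : ∀ k, (K k).IsSemisimple) (hcomm : ∀ j k, K j * K k = K k * K j)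
    (hl : ∀ k, HasDistinctSpectrum (K k) (l k)) (x : U) :
    ⨆ i, jointAddend K l i x = ⊤ := by
  have : FiniteDimensional ℝ (Tan n (x : M)) :=
    inferInstanceAs (FiniteDimensional ℝ (Model n))
  have h1 := Module.End.iSup_iInf_maxGenEigenspace_eq_top_of_iSup_maxGenEigenspace_eq_top_of_commute
    (fun k => (K k x).toLinearMap)
    (fun j k _ => by
      ext w
      exact congrArg (fun F : OpField n U => F x w) (hcomm j k))
    (fun k => by
      rw [eq_top_iff, ← iSup_eigenspace_eq_top (hK k) x]
      exact iSup_mono fun c => by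
        rw [maxGenEigenspace_eq_eigenspace_of_iSup_eq_top _ (iSup_eigenspace_eq_top (hK k) x)])
  rw [eq_top_iff, ← h1]
  refine iSup_le fun χ => ?_
  simp only [maxGenEigenspace_eq_eigenspace_of_iSup_eq_top _ (iSup_eigenspace_eq_top (hK _) x)]
  by_cases h : ∀ k, ∃ i, χ k = l k i x
  · choose i hi using h
    refine le_iSup_of_le i (le_of_eq ?_)
    simp only [jointAddend, eigenDistribution, hi]
  -- Some `χ k` is not an eigenvalue of `K k` at `x`, so this family contributes the zero space.
  · push Not at h
    obtain ⟨k, hk⟩ := h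
    have : Module.End.eigenspace (K k x).toLinearMap (χ k) = ⊥ := by
      by_contra hne
      obtain ⟨i, hi⟩ := ((hl k x).2 (χ k)).1 (Module.End.hasEigenvalue_iff.2 hne)
      exact hk i hi
    exact (iInf_le _ k).trans (this.le.trans bot_le)

lemma OpField.ext_of_iSup_eq_top {U : Opens M} {ι : Type*} {x : U}
    {J : ι → Submodule ℝ (Tan n (x : M))} (hJ : ⨆ i, J i = ⊤)
    {A B : Tan n (x : M) →L[ℝ] Tan n (x : M)} (h : ∀ i, ∀ w ∈ J i, A w = B w) : A = B := by
  ext1 w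
  have hw : w ∈ ⨆ i, J i := hJ ▸ Submodule.mem_top
  induction hw using Submodule.iSup_induction' with
  | mem i w hw => exact h i w hw
  | zero => rw [map_zero, map_zero]
  | add x y _ _ hx hy => rw [map_add, map_add, hx, hy]

/-- The projections onto the addends of the joint spectral decomposition belong to every
subalgebra containing the operators. -/
lemma exists_joint_projections {U : Opens M} {m : ℕ}
    {K : Fin m → OpField n U} {s : Fin m → ℕ} {l : (k : Fin m) → Fin (s k) → SmoothFun n U}
    (hl : ∀ k, HasDistinctSpectrum (K k) (l k))
    (H : Subalgebra (SmoothFun n U) (OpField n U)) (hKH : ∀ k, K k ∈ H) :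
    ∃ π : ((k : Fin m) → Fin (s k)) → OpField n U, (∀ i, π i ∈ H) ∧
      ∀ i x, (∀ w ∈ jointAddend K l i x, π i x w = w) ∧
        ∀ j ≠ i, ∀ w ∈ jointAddend K l j x, π i x w = 0 := by
  classical
  have hp : ∀ k, ∃ p : Fin (s k) → Polynomial (SmoothFun n U), ∀ i, (p i).eval (l k i) = 1 ∧
      ∀ j, j ≠ i → (p i).eval (l k j) = 0 := fun k =>
    exists_lagrange_of_isUnit_sub _ (isUnit_sub_of_injective (l k) fun x => (hl k x).1)
  choose p hp using hp
  obtain ⟨c, hc⟩ : ∃ c : (k : Fin m) → Fin (s k) → ℝ,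
      Function.Injective fun i : (k : Fin m) → Fin (s k) => ∑ k, c k (i k) := by
    -- Mixed-radix digits: index `k` has place value the product of the earlier `s t`, so the sum
    -- over `k` determines the multi-index.
    refine ⟨fun k j => ((j * ∏ t, s (Fin.castLE k.is_lt.le t) : ℕ) : ℝ), fun i j hij => ?_⟩
    refine finPiFinEquiv.injective (Fin.ext ?_)
    rw [finPiFinEquiv_apply, finPiFinEquiv_apply]
    dsimp only at hij
    exact_mod_cast hij
  let cst : ℝ → SmoothFun n U := fun r => ContMDiffMap.const r
  -- Each `p k i` of `K k` acts as a projection on the joint addends. The weights `c` make `A` a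
  -- single operator with constant eigenvalues, distinct for distinct multi-indices; interpolating
  -- in `A` then yields the joint projections.
  let A : OpField n U := ∑ k, ∑ i, cst (c k i) • Polynomial.aeval (K k) (p k i)
  have hA : A ∈ H := sum_mem fun k _ => sum_mem fun i _ => H.smul_mem
    (Polynomial.aeval_mem_adjoin_singleton _ _ |> Algebra.adjoin_le (by simpa using hKH k)) _
  have hAw : ∀ i x, ∀ w ∈ jointAddend K l i x, A x w = (cst (∑ k, c k (i k))) x • w := by
    intro i x w hw
    have hw' : ∀ k, K k x w = l k (i k) x • w := fun k =>
      Module.End.mem_eigenspace_iff.1 ((Submodule.mem_iInf _).1 hw k)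
    have h1 : A x w = ∑ k, ∑ j, c k j • (Polynomial.aeval (K k) (p k j)) x w := by
      simp only [A, OpField.sum_apply, sum_apply]
      rfl
    rw [h1, show (cst (∑ k, c k (i k))) x = ∑ k, c k (i k) from rfl, Finset.sum_smul]
    refine Finset.sum_congr rfl fun k _ => ?_
    rw [Finset.sum_eq_single (i k)]
    · rw [OpField.aeval_apply_eigenvector _ _ _ _ _ (hw' k), (hp k (i k)).1]
      exact congrArg _ (one_smul ℝ w)
    · intro j _ hj
      rw [OpField.aeval_apply_eigenvector _ _ _ _ _ (hw' k), (hp k j).2 _ hj.symm]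
      exact (congrArg _ (zero_smul ℝ w)).trans (smul_zero _)
    · simp
  obtain ⟨q, hq⟩ := exists_lagrange_of_isUnit_sub
    (fun i : (k : Fin m) → Fin (s k) => cst (∑ k, c k (i k)))
    (isUnit_sub_of_injective _ fun x => hc)
  refine ⟨fun i => Polynomial.aeval A (q i), fun i =>
    (Algebra.adjoin_le (by simpa using hA)) (Polynomial.aeval_mem_adjoin_singleton _ _),
    fun i x => ⟨fun w hw => ?_, fun j hj w hw => ?_⟩⟩
  · rw [OpField.aeval_apply_eigenvector _ _ _ _ _ (hAw i x w hw), (hq i).1]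
    exact one_smul ℝ w
  · rw [OpField.aeval_apply_eigenvector _ _ _ _ _ (hAw j x w hw), (hq i).2 j hj]
    exact zero_smul ℝ w

end Joint

/-! ### Zero sets of smooth idempotents; smoothness of combinations -/

section Smooth

variable {n : ℕ} {M : Type*} [TopologicalSpace M] [ChartedSpace (Model n) M]
  [IsManifold 𝓘(ℝ, Model n) ∞ M]

open Bundle Filter Topology

/-- A nonzero idempotent has norm at least `1`, because the norm is submultiplicative; this isolates
`0` among the idempotents. -/
lemma eq_zero_of_mul_self_of_norm_lt_one {E : Type*} [NormedAddCommGroup E] [NormedSpace ℝ E]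
    (A : E →L[ℝ] E) (hA : A * A = A) (h1 : ‖A‖ < 1) : A = 0 := by
  by_contra h
  have hpos : 0 < ‖A‖ := norm_pos_iff.2 h
  have : ‖A‖ ≤ ‖A‖ * ‖A‖ := by
    conv_lhs => rw [← hA]
    exact norm_mul_le A A
  nlinarith

/-- In a local trivialization `K` becomes a continuous family of idempotents on the fixed space
`Model n`. Being nonzero is an open condition, and so is having norm less than `1`, which for
idempotents means being zero. -/
lemma eventually_eq_zero_iff_of_isSmooth {U : Opens M} {K : OpField n U} (hK : K.IsSmooth)
    (hidem : K * K = K) (x : U) : ∀ᶠ y in 𝓝 x, (K y = 0 ↔ K x = 0) := by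
  have h1 := ((contMDiffWithinAt_hom_bundle _).1 (hK x x.2)).2.continuousWithinAt.continuousAt
    (U.isOpen.mem_nhds x.2)
  dsimp only at h1
  set e := trivializationAt (Model n) (TangentSpace 𝓘(ℝ, Model n)) (x : M) with he
  set A : M → (Model n →L[ℝ] Model n) := fun y => ContinuousLinearMap.inCoordinates
    (Model n) (TangentSpace 𝓘(ℝ, Model n)) (Model n) (TangentSpace 𝓘(ℝ, Model n)) (x : M) y (x : M) y
    (K.ext y) with hA
  have hAeq : ∀ y (hy : y ∈ e.baseSet), ∀ v, A y v =
      e.continuousLinearEquivAt ℝ y hy (K.ext y ((e.continuousLinearEquivAt ℝ y hy).symm v)) := by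
    intro y hy v
    simp only [hA, ContinuousLinearMap.inCoordinates_eq hy hy]
    rfl
  have hzero : ∀ y : U, (y : M) ∈ e.baseSet → (A y = 0 ↔ K y = 0) := by
    intro y hy
    have hext := K.ext_apply y.2
    constructor
    · intro h
      ext1 w
      have := hAeq y hy (e.continuousLinearEquivAt ℝ y hy w)
      rw [h, ContinuousLinearEquiv.symm_apply_apply, hext] at this
      exact (e.continuousLinearEquivAt ℝ (y : M) hy).map_eq_zero_iff.1 this.symm
    · intro h
      ext1 v
      rw [hAeq y hy, hext]
      have : K ⟨y, y.2⟩ = 0 := h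
      rw [this, zero_apply, map_zero]
      rfl
  have hmul : ∀ y : U, (y : M) ∈ e.baseSet → A y * A y = A y := by
    intro y hy
    ext1 v
    change A y (A y v) = A y v
    rw [hAeq y hy, hAeq y hy,
      ContinuousLinearEquiv.symm_apply_apply, K.ext_apply y.2]
    exact congrArg _ (congrArg (fun F : OpField n U => F y _) hidem)
  have hbase : ∀ᶠ y : U in 𝓝 x, (y : M) ∈ e.baseSet :=
    continuous_subtype_val.continuousAt.eventually
      (e.open_baseSet.mem_nhds (FiberBundle.mem_baseSet_trivializationAt' (x : M)))
  have hcont : Tendsto (fun y : U => A y) (𝓝 x) (𝓝 (A x)) :=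
    h1.tendsto.comp continuous_subtype_val.continuousAt
  have hx := hzero x (FiberBundle.mem_baseSet_trivializationAt' (x : M))
  by_cases h0 : K x = 0
  · have : ∀ᶠ y : U in 𝓝 x, ‖A y‖ < 1 := by
      refine hcont.norm.eventually (gt_mem_nhds ?_)
      rw [hx.2 h0, norm_zero]
      exact one_pos
    filter_upwards [this, hbase] with y hy hyb
    exact iff_of_true ((hzero y hyb).1 (eq_zero_of_mul_self_of_norm_lt_one _ (hmul y hyb) hy)) h0
  · have : ∀ᶠ y : U in 𝓝 x, A y ≠ 0 :=
      hcont.eventually_ne fun h => h0 (hx.1 h)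
    filter_upwards [this, hbase] with y hy hyb
    exact iff_of_false (fun h => hy ((hzero y hyb).2 h)) h0

/-- The indicator function of the zero set of a smooth field of projections is smooth. -/
lemma exists_indicator_zeros {U : Opens M} {K : OpField n U} (hK : K.IsSmooth)
    (hidem : K * K = K) :
    ∃ f : SmoothFun n U, (∀ x, K x = 0 → f x = 1) ∧ ∀ x, K x ≠ 0 → f x = 0 := by
  classical
  have hsm : ContMDiff 𝓘(ℝ, Model n) 𝓘(ℝ, ℝ) ∞ fun x : U => if K x = 0 then (1 : ℝ) else 0 := by
    intro x
    refine (contMDiffAt_const (c := if K x = 0 then (1 : ℝ) else 0)).congr_of_eventuallyEq ?_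
    filter_upwards [eventually_eq_zero_iff_of_isSmooth hK hidem x] with y hy
    simp only [hy]
  exact ⟨⟨_, hsm⟩, fun x hx => if_pos hx, fun x hx => if_neg hx⟩

open Classical in
lemma isSmooth_smul {U : Opens M} (f : SmoothFun n U) {K : OpField n U} (hK : K.IsSmooth) :
    (f • K).IsSmooth := by
  have hf : ContMDiffOn 𝓘(ℝ, Model n) 𝓘(ℝ, ℝ) ∞
      (fun x => if h : x ∈ U then f ⟨x, h⟩ else 0) (U : Set M) := fun x hx =>
    (contMDiffAt_of_smoothFun f (fun y => dif_pos y.2) hx).contMDiffWithinAt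
  refine (ContMDiffOn.smul_section hf hK).congr fun x hx => ?_
  have hx' : x ∈ U := hx
  congr 1
  rw [OpField.ext_apply _ hx', Pi.smul_apply', OpField.ext_apply _ hx', dif_pos hx']
  rfl

lemma isSmooth_sum {ι : Type*} {U : Opens M} (s : Finset ι) {F : ι → OpField n U}
    (hF : ∀ i ∈ s, (F i).IsSmooth) : (∑ i ∈ s, F i).IsSmooth := by
  refine (ContMDiffOn.sum_section (t := fun i => (F i).ext) hF).congr fun x hx => ?_
  have hx' : x ∈ U := hx
  congr 1
  rw [OpField.ext_apply _ hx', OpField.sum_apply]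
  exact Finset.sum_congr rfl fun i _ => (OpField.ext_apply _ hx').symm

lemma isSmooth_res {U V : Opens M} (h : V ≤ U) {K : OpField n U} (hK : K.IsSmooth) :
    (K.res h).IsSmooth := by
  refine (ContMDiffOn.mono hK (show (V : Set M) ⊆ U from h)).congr fun x hx => ?_
  have hx' : x ∈ V := hx
  congr 1
  rw [OpField.ext_apply _ hx', OpField.ext_apply _ (h hx')]
  rfl

end Smooth

/-! ### The idempotent basis of the algebra and its cyclic generators -/

section Structure

variable {n : ℕ} {M : Type*} [TopologicalSpace M] [ChartedSpace (Model n) M]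

lemma subsingleton_opField {U : Opens M} [IsEmpty U] : Subsingleton (OpField n U) :=
  inferInstanceAs (Subsingleton ((x : U) → (Tan n (x : M) →L[ℝ] Tan n (x : M))))

/-- The index set of the addends of the joint spectral decomposition that do not vanish
identically. -/
abbrev AddendIndex {U : Opens M} {m : ℕ} (K : Fin m → OpField n U) {s : Fin m → ℕ}
    (l : (k : Fin m) → Fin (s k) → SmoothFun n U) : Type :=
  {i : (k : Fin m) → Fin (s k) // ∃ x : U, jointAddend K l i x ≠ ⊥}

lemma apply_of_mem_jointAddend {U : Opens M} {m : ℕ} {K : Fin m → OpField n U} {s : Fin m → ℕ}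
    {l : (k : Fin m) → Fin (s k) → SmoothFun n U} {i : (k : Fin m) → Fin (s k)} {x : U}
    {w : Tan n (x : M)} (hw : w ∈ jointAddend K l i x) (k : Fin m) :
    K k x w = l k (i k) x • w :=
  Module.End.mem_eigenspace_iff.1 ((Submodule.mem_iInf _).1 hw k)

variable [IsManifold 𝓘(ℝ, Model n) ∞ M]

open Classical in
/-- The smooth projections onto the addends of the joint spectral decomposition: they form
a complete system of orthogonal idempotents which spans the algebra. If there are at most `m`
addends, `m` being the rank of the algebra, then there are exactly `m`, and none vanishes at
any point. -/
lemma exists_complete_projections {U : Opens M} [Nonempty U] {m : ℕ}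
    {H : Subalgebra (SmoothFun n U) (OpField n U)} (hsm : ∀ F ∈ H, F.IsSmooth)
    (hss : IsSemisimpleAlgebra H) (hab : IsAbelianAlgebra H)
    (K : Module.Basis (Fin m) (SmoothFun n U) H) {s : Fin m → ℕ}
    {l : (k : Fin m) → Fin (s k) → SmoothFun n U}
    (hl : ∀ k, HasDistinctSpectrum (K k : OpField n U) (l k))
    (hv : numAddends (fun k => (K k : OpField n U)) l ≤ m) :
    ∃ π : AddendIndex (fun k => (K k : OpField n U)) l → OpField n U,
      CompleteOrthogonalIdempotents π ∧ (∀ i, π i ∈ H) ∧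
      (∀ F ∈ H, ∃ f : AddendIndex (fun k => (K k : OpField n U)) l → SmoothFun n U,
        F = ∑ i, f i • π i) ∧
      Fintype.card (AddendIndex (fun k => (K k : OpField n U)) l) = m ∧
      (∀ i x, π i x ≠ 0) ∧
      ∀ (i : AddendIndex (fun k => (K k : OpField n U)) l) (x : U),
        ∀ w ∈ jointAddend (fun k => (K k : OpField n U)) l i x,
          π i x w = w ∧ ∀ j ≠ i, π j x w = 0 := by
  set K' : Fin m → OpField n U := fun k => (K k : OpField n U) with hK'
  have hKH : ∀ k, K' k ∈ H := fun k => (K k).2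
  have htop : ∀ x, ⨆ i, jointAddend K' l i x = ⊤ :=
    iSup_jointAddend_eq_top (fun k => hss _ (hKH k)) (fun j k => hab _ (hKH j) _ (hKH k)) hl
  obtain ⟨P, hPH, hP⟩ := exists_joint_projections hl H hKH
  let π : AddendIndex K' l → OpField n U := fun i => P i
  -- The addends span every tangent space, and one that is zero at `x` imposes no condition there.
  have hext : ∀ A B : OpField n U, (∀ (i : AddendIndex K' l) (x : U),
      ∀ w ∈ jointAddend K' l i x, A x w = B x w) → A = B := by
    intro A B h
    funext x
    refine OpField.ext_of_iSup_eq_top (htop x) fun i w hw => ?_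
    by_cases hi : jointAddend K' l i x = ⊥
    · rw [hi, Submodule.mem_bot] at hw
      rw [hw, map_zero, map_zero]
    · exact h ⟨i, x, hi⟩ x w hw
  have hself : ∀ i : AddendIndex K' l, ∀ x, ∀ w ∈ jointAddend K' l i x, π i x w = w :=
    fun i x => (hP i x).1
  have hother : ∀ i j : AddendIndex K' l, j ≠ i → ∀ x, ∀ w ∈ jointAddend K' l j x, π i x w = 0 :=
    fun i j hij x => (hP i x).2 j fun h => hij (Subtype.ext h)
  have hsum : ∀ (f : AddendIndex K' l → SmoothFun n U) (i : AddendIndex K' l) (x : U),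
      ∀ w ∈ jointAddend K' l i x, (∑ j, f j • π j) x w = f i x • w := by
    intro f i x w hw
    have h1 : (∑ j, f j • π j) x w = ∑ j, f j x • π j x w := by
      simp only [OpField.sum_apply, sum_apply]
      rfl
    rw [h1, Finset.sum_eq_single i, hself i x w hw]
    · intro j _ hj
      rw [hother j i hj.symm x w hw]
      exact smul_zero _
    · simp
  have hcomp : CompleteOrthogonalIdempotents π := by
    refine ⟨⟨fun i => ?_, fun i j hij => ?_⟩, ?_⟩
    · refine hext _ _ fun j x w hw => ?_
      rw [OpField.mul_apply]
      by_cases hj : j = i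
      · subst hj
        rw [hself j x w hw, hself j x w hw]
      · rw [hother i j hj x w hw, map_zero]
    · refine hext _ _ fun t x w hw => ?_
      change π i x (π j x w) = 0
      by_cases ht : t = j
      · subst ht
        rw [hself t x w hw, hother i t hij.symm x w hw]
      · rw [hother j t ht x w hw, map_zero]
    · refine hext _ _ fun j x w hw => ?_
      have := hsum (fun _ => 1) j x w hw
      simp only [one_smul] at this
      exact this.trans (one_smul ℝ w)
  have hKπ : ∀ k, K' k = ∑ i : AddendIndex K' l, l k (i.1 k) • π i := fun k =>
    hext _ _ fun i x w hw => by
      rw [hsum _ i x w hw, apply_of_mem_jointAddend hw]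
  have hspan : ∀ F ∈ H, ∃ f : AddendIndex K' l → SmoothFun n U, F = ∑ i, f i • π i := by
    intro F hF
    refine ⟨fun i => ∑ k, K.repr ⟨F, hF⟩ k * l k (i.1 k), ?_⟩
    have h1 := congrArg (Subtype.val : H → OpField n U) (K.sum_repr ⟨F, hF⟩)
    rw [AddSubmonoidClass.coe_finsetSum] at h1
    change ∑ k, K.repr ⟨F, hF⟩ k • K' k = F at h1
    refine h1.symm.trans ?_
    simp only [Finset.sum_smul, mul_smul]
    rw [Finset.sum_comm]
    exact Finset.sum_congr rfl fun k _ => by rw [← Finset.smul_sum, ← hKπ]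
  let A : Matrix (Fin m) (AddendIndex K' l) (SmoothFun n U) := fun k i => l k (i.1 k)
  let B : Matrix (AddendIndex K' l) (Fin m) (SmoothFun n U) := fun i k =>
    K.repr ⟨π i, hPH i⟩ k
  have hπK : ∀ i, π i = ∑ k, B i k • K' k := by
    intro i
    have h1 := congrArg (Subtype.val : H → OpField n U) (K.sum_repr ⟨π i, hPH i⟩)
    rw [AddSubmonoidClass.coe_finsetSum] at h1
    exact h1.symm
  have hindep : ∀ g : Fin m → SmoothFun n U, ∑ k, g k • K' k = 0 → ∀ k, g k = 0 := by
    intro g hg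
    refine Fintype.linearIndependent_iff.1 K.linearIndependent g (Subtype.ext ?_)
    rw [AddSubmonoidClass.coe_finsetSum]
    exact hg
  have hAB : A * B = 1 := by
    ext1 k j
    have h1 : ∑ j, ((A * B) k j - (1 : Matrix (Fin m) (Fin m) (SmoothFun n U)) k j) • K' j = 0 := by
      simp only [sub_smul, Finset.sum_sub_distrib, Matrix.one_apply, ite_smul, one_smul, zero_smul,
        Finset.sum_ite_eq, Finset.mem_univ, if_true]
      rw [sub_eq_zero]
      conv_rhs => rw [hKπ k]
      simp only [Matrix.mul_apply, Finset.sum_smul, mul_smul]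
      rw [Finset.sum_comm]
      exact Finset.sum_congr rfl fun i _ => by rw [← Finset.smul_sum, ← hπK]
    exact sub_eq_zero.1 (hindep _ h1 j)
  have hcard : Fintype.card (AddendIndex K' l) = m := by
    refine le_antisymm ?_ ?_
    · rw [← Nat.card_eq_fintype_card]
      exact hv
    -- At a point, the `m × m` identity factors through a space of dimension the number of addends.
    · obtain ⟨x⟩ := ‹Nonempty U›
      have h1 : A.map (evalAt x) * B.map (evalAt x) = 1 := by
        rw [← Matrix.map_mul, hAB, Matrix.map_one _ (map_zero _) (map_one _)]
      have h2 := Matrix.rank_mul_le_left (A.map (evalAt x)) (B.map (evalAt x))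
      rw [h1, Matrix.rank_one, Fintype.card_fin] at h2
      exact h2.trans (Matrix.rank_le_card_width _)
  have hBA : B * A = 1 :=
    (Matrix.mul_eq_one_comm_of_card_eq _ _ _ (by rw [hcard, Fintype.card_fin])).1 hAB
  refine ⟨π, hcomp, fun i => hPH i, hspan, hcard, fun i x hx => ?_, fun i x w hw =>
    ⟨hself i x w hw, fun j hj => hother j i hj.symm x w hw⟩⟩
  -- Multiplication by the indicator of the zero set turns vanishing of `π i` at the one point `x`
  -- into the global relation `f • π i = 0`, to which freeness applies.
  obtain ⟨f, hf1, hf0⟩ := exists_indicator_zeros (hsm _ (hPH i)) (hcomp.idem i)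
  have hfπ : f • π i = 0 := by
    funext y
    rw [OpField.smul_apply]
    by_cases hy : π i y = 0
    · rw [hy]
      exact smul_zero _
    · rw [hf0 y hy]
      exact zero_smul _ _
  have hfB : ∀ k, f * B i k = 0 := hindep _ (by
    simp only [mul_smul]
    rw [← Finset.smul_sum, ← hπK, hfπ])
  have hB0 : ∀ k, B i k x = 0 := fun k => by
    have h1 : f x * B i k x = 0 := congrArg (fun g : SmoothFun n U => g x) (hfB k)
    rwa [hf1 x hx, one_mul] at h1
  have h1 := congrArg (evalAt x) (congrFun (congrFun hBA i) i)
  rw [Matrix.mul_apply, map_sum, Matrix.one_apply_eq, map_one] at h1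
  refine zero_ne_one (h1 ▸ (Finset.sum_eq_zero fun k _ => ?_).symm : (0 : ℝ) = 1)
  rw [map_mul]
  exact mul_eq_zero_of_left (hB0 k) _

/-- A combination of a spanning complete system of orthogonal idempotents with coefficients that
are pairwise distinct at every point is a cyclic generator. -/
lemma isCyclicGenerator_sum {ι : Type*} [Fintype ι] {U : Opens M}
    {H : Subalgebra (SmoothFun n U) (OpField n U)} {π : ι → OpField n U}
    (hπ : CompleteOrthogonalIdempotents π) (hπ0 : ∀ i x, π i x ≠ 0)
    (hH : H = Algebra.adjoin (SmoothFun n U) (Set.range π))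
    (μ : ι → SmoothFun n U) (hμ : ∀ x, Function.Injective fun i => μ i x)
    (hsm : (∑ i, μ i • π i).IsSmooth) (hha : (∑ i, μ i • π i).IsHaantjes) :
    IsCyclicGenerator H (Fintype.card ι) (∑ i, μ i • π i) where
  smooth := hsm
  haantjes := hha
  minpoly_degree x := by
    rw [OpField.sum_apply]
    exact minpoly_natDegree_sum_idempotents (π := fun i => π i x)
      (hπ.map (OpField.evalHom x)) (fun i => hπ0 i x) (fun i => μ i x) (hμ x)
  generates := by
    rw [hH]
    refine le_antisymm (Algebra.adjoin_le ?_) (Algebra.adjoin_le ?_)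
    · rintro _ ⟨i, rfl⟩
      exact idempotent_mem_adjoin hπ μ (isUnit_sub_of_injective μ hμ) i
    · rintro _ rfl
      exact sum_mem fun i _ => Subalgebra.smul_mem _ (Algebra.subset_adjoin (Set.mem_range_self i)) _

end Structure

/-! ### Coordinate frames and Lie brackets in a chart -/

section Charts

variable {n : ℕ} {M : Type*} [TopologicalSpace M] [ChartedSpace (Model n) M]
 {e : OpenPartialHomeomorph M (Model n)}

open VectorField

lemma mdifferentiable_of_mem_maximalAtlas
    (he : e ∈ IsManifold.maximalAtlas 𝓘(ℝ, Model n) ∞ M) :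
    e.MDifferentiable 𝓘(ℝ, Model n) 𝓘(ℝ, Model n) :=
  ⟨(contMDiffOn_of_mem_maximalAtlas he).mdifferentiableOn (by simp),
    (contMDiffOn_symm_of_mem_maximalAtlas he).mdifferentiableOn (by simp)⟩

lemma mfderiv_coordField (he : e ∈ IsManifold.maximalAtlas 𝓘(ℝ, Model n) ∞ M) {x : M}
    (hx : x ∈ e.source) (i : Fin n) :
    mfderiv 𝓘(ℝ, Model n) 𝓘(ℝ, Model n) e x (coordField e i x) =
      (EuclideanSpace.single i (1 : ℝ) : Model n) := by
  have h1 : mfderiv 𝓘(ℝ, Model n) 𝓘(ℝ, Model n) e x =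
    ((mdifferentiable_of_mem_maximalAtlas he).mfderiv hx :
      TangentSpace 𝓘(ℝ, Model n) x →L[ℝ] TangentSpace 𝓘(ℝ, Model n) (e x)) := rfl
  change mfderiv 𝓘(ℝ, Model n) 𝓘(ℝ, Model n) e x
    ((mfderiv 𝓘(ℝ, Model n) 𝓘(ℝ, Model n) e x).inverse (EuclideanSpace.single i (1 : ℝ))) = _
  rw [h1, ContinuousLinearMap.inverse_equiv]
  exact ContinuousLinearEquiv.apply_symm_apply _ _

lemma coordForm_coordField (he : e ∈ IsManifold.maximalAtlas 𝓘(ℝ, Model n) ∞ M) {x : M}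
    (hx : x ∈ e.source) (i j : Fin n) :
    coordForm e j x (coordField e i x) = if j = i then 1 else 0 := by
  have : coordForm e j x (coordField e i x) =
    (EuclideanSpace.single i (1 : ℝ) : Model n) j :=
    congrArg (fun v : Model n => v j) (mfderiv_coordField he hx i)
  rw [this, PiLp.single_apply]

lemma eq_of_coordForm_eq (he : e ∈ IsManifold.maximalAtlas 𝓘(ℝ, Model n) ∞ M) {x : M}
    (hx : x ∈ e.source) {v w : Tan n x} (h : ∀ i, coordForm e i x v = coordForm e i x w) :
    v = w := by
  refine (mdifferentiable_of_mem_maximalAtlas he).mfderiv_injective hx ?_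
  exact PiLp.ext h

lemma sum_coordForm_smul_coordField (he : e ∈ IsManifold.maximalAtlas 𝓘(ℝ, Model n) ∞ M)
    {x : M} (hx : x ∈ e.source) (w : Tan n x) :
    ∑ i, coordForm e i x w • coordField e i x = w := by
  refine eq_of_coordForm_eq he hx fun j => ?_
  simp [map_sum, coordForm_coordField he hx]

lemma coordForm_diagonalOperator (he : e ∈ IsManifold.maximalAtlas 𝓘(ℝ, Model n) ∞ M) {m : ℕ}
    (b : Fin n → Fin m) (lam : Fin m → SmoothFun n (chartDomain e)) (x : chartDomain e)
    (w : Tan n (x : M)) (j : Fin n) :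
    coordForm e j x (diagonalOperator e b lam x w) = lam (b j) x * coordForm e j x w := by
  have hx : (x : M) ∈ e.source := x.2
  have h1 : diagonalOperator e b lam x w =
      ∑ a, lam a x • ∑ i with b i = a, coordForm e i x w • coordField e i (x : M) := by
    simp [diagonalOperator, sum_apply]
  rw [h1]
  simp [map_sum, coordForm_coordField he hx]

/-- The expression of a vector field in the chart `e`. -/
noncomputable def chartField (e : OpenPartialHomeomorph M (Model n)) (X : (x : M) → Tan n x) :
    Model n → Model n :=
  mpullback 𝓘(ℝ, Model n) 𝓘(ℝ, Model n) e.symm X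

lemma inverse_mfderiv_symm (he : e ∈ IsManifold.maximalAtlas 𝓘(ℝ, Model n) ∞ M) {q : Model n}
    (hq : q ∈ e.target) :
    (mfderiv 𝓘(ℝ, Model n) 𝓘(ℝ, Model n) e.symm q).inverse =
      mfderiv 𝓘(ℝ, Model n) 𝓘(ℝ, Model n) e (e.symm q) := by
  have hE := mdifferentiable_of_mem_maximalAtlas he
  refine ContinuousLinearMap.inverse_eq ?_ ?_
  · have := hE.symm_comp_deriv (e.map_target hq)
    rw [e.right_inv hq] at this
    exact this
  · exact hE.comp_symm_deriv hq

lemma isInvertible_mfderiv_symm (he : e ∈ IsManifold.maximalAtlas 𝓘(ℝ, Model n) ∞ M)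
    {q : Model n} (hq : q ∈ e.target) :
    (mfderiv 𝓘(ℝ, Model n) 𝓘(ℝ, Model n) e.symm q).IsInvertible :=
  ⟨(mdifferentiable_of_mem_maximalAtlas he).symm.mfderiv hq, rfl⟩

lemma chartField_apply (he : e ∈ IsManifold.maximalAtlas 𝓘(ℝ, Model n) ∞ M)
    (X : (x : M) → Tan n x) {q : Model n} (hq : q ∈ e.target) (i : Fin n) :
    chartField e X q i = coordForm e i (e.symm q) (X (e.symm q)) := by
  rw [chartField, mpullback_apply, inverse_mfderiv_symm he hq]
  rfl

variable [IsManifold 𝓘(ℝ, Model n) ∞ M]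

/-- Smoothness of a vector field at a point. -/
abbrev SmoothVectorFieldAt (X : (x : M) → Tan n x) (x : M) : Prop :=
  ContMDiffAt 𝓘(ℝ, Model n) (𝓘(ℝ, Model n)).tangent ∞
    (fun x => (⟨x, X x⟩ : TangentBundle 𝓘(ℝ, Model n) M)) x

lemma differentiableAt_chartField (he : e ∈ IsManifold.maximalAtlas 𝓘(ℝ, Model n) ∞ M) {x : M}
    (hx : x ∈ e.source) {X : (x : M) → Tan n x} (hX : SmoothVectorFieldAt X x) :
    DifferentiableAt ℝ (chartField e X) (e x) := by
  have h1 : ContMDiffAt 𝓘(ℝ, Model n) 𝓘(ℝ, Model n) ∞ e.symm (e x) :=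
    contMDiffAt_symm_of_mem_maximalAtlas he (e.map_source hx)
  rw [← e.left_inv hx] at hX
  have h2 := ContMDiffAt.mpullback_vectorField_preimage (n := ∞) (m := ∞) hX h1
    (isInvertible_mfderiv_symm he (e.map_source hx)) (by simp)
  exact (contMDiffAt_vectorSpace_iff_contDiffAt.1 h2).differentiableAt (by simp)

/-- The bracket is natural under pullback by `e.symm`, and on the model space it is the difference
of directional derivatives. -/
lemma coordForm_mlieBracket (he : e ∈ IsManifold.maximalAtlas 𝓘(ℝ, Model n) ∞ M) {x : M}
    (hx : x ∈ e.source) {X Y : (x : M) → Tan n x} (hX : SmoothVectorFieldAt X x)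
    (hY : SmoothVectorFieldAt Y x) (i : Fin n) :
    coordForm e i x (mlieBracket 𝓘(ℝ, Model n) X Y x) =
      fderiv ℝ (fun q => chartField e Y q i) (e x) (chartField e X (e x)) -
        fderiv ℝ (fun q => chartField e X q i) (e x) (chartField e Y (e x)) := by
  have hq := e.map_source hx
  have hsymm : ContMDiffAt 𝓘(ℝ, Model n) 𝓘(ℝ, Model n) ∞ e.symm (e x) :=
    contMDiffAt_symm_of_mem_maximalAtlas he hq
  have : IsManifold 𝓘(ℝ, Model n) (minSmoothness ℝ 2) M := by
    rw [minSmoothness_of_isRCLikeNormedField]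
    exact IsManifold.of_le (n := ∞) ENat.LEInfty.out
  have hX' := hX
  have hY' := hY
  rw [← e.left_inv hx] at hX' hY'
  have h1 := mpullback_mlieBracket (n := ∞) (hX'.mdifferentiableAt (by simp))
    (hY'.mdifferentiableAt (by simp)) hsymm
    (by rw [minSmoothness_of_isRCLikeNormedField]; exact ENat.LEInfty.out)
  have h2 := congrArg (fun v : Model n => v i) h1
  have h3 := chartField_apply he (mlieBracket 𝓘(ℝ, Model n) X Y) hq i
  rw [e.left_inv hx] at h3
  rw [← h3]
  refine h2.trans ?_
  have hdX := differentiableAt_chartField he hx hX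
  have hdY := differentiableAt_chartField he hx hY
  have hcomp : ∀ {F : Model n → Model n}, DifferentiableAt ℝ F (e x) → ∀ v,
      fderiv ℝ (fun q => F q i) (e x) v = fderiv ℝ F (e x) v i := by
    intro F hF v
    have := ((EuclideanSpace.proj i : Model n →L[ℝ] ℝ).hasFDerivAt.comp (e x) hF.hasFDerivAt)
    exact congrArg (fun f : Model n →L[ℝ] ℝ => f v) this.fderiv
  rw [hcomp hdX, hcomp hdY, ← mlieBracketWithin_univ, mlieBracketWithin_eq_lieBracketWithin]
  exact congrArg (fun F : Model n → Model n => F (e x) i)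
    (lieBracketWithin_univ (𝕜 := ℝ) (V := chartField e X) (W := chartField e Y))

end Charts

/-! ### Torsions of operators diagonal in a chart -/

section Torsion

variable {n : ℕ} {M : Type*} [TopologicalSpace M] [ChartedSpace (Model n) M]
  {e : OpenPartialHomeomorph M (Model n)}

open Filter Topology

open Classical in
/-- The expression in the chart `e` of a function on the domain of `e`. -/
noncomputable def chartFun (e : OpenPartialHomeomorph M (Model n))
    (f : SmoothFun n (chartDomain e)) (q : Model n) : ℝ :=
  if h : e.symm q ∈ chartDomain e then f ⟨e.symm q, h⟩ else 0

/-- The differential of a function on the domain of the chart `e`. -/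
noncomputable def chartDiff (e : OpenPartialHomeomorph M (Model n))
    (f : SmoothFun n (chartDomain e)) (x : M) : Tan n x →L[ℝ] ℝ :=
  (fderiv ℝ (chartFun e f) (e x)).comp
    (mfderiv 𝓘(ℝ, Model n) 𝓘(ℝ, Model n) e x : Tan n x →L[ℝ] Model n)

lemma chartFun_apply (f : SmoothFun n (chartDomain e)) {q : Model n} (hq : q ∈ e.target) :
    chartFun e f q = f ⟨e.symm q, e.map_target hq⟩ := dif_pos _

lemma chartFun_self (f : SmoothFun n (chartDomain e)) (x : chartDomain e) :
    chartFun e f (e x) = f x := by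
  rw [chartFun_apply f (e.map_source x.2)]
  exact congrArg f (Subtype.ext (e.left_inv x.2))

lemma differentiableAt_chartFun
    (he : e ∈ IsManifold.maximalAtlas 𝓘(ℝ, Model n) ∞ M) (f : SmoothFun n (chartDomain e)) {x : M}
    (hx : x ∈ e.source) : DifferentiableAt ℝ (chartFun e f) (e x) := by
  classical
  have h1 : ContMDiffAt 𝓘(ℝ, Model n) 𝓘(ℝ, ℝ) ∞
      (fun y => if h : y ∈ chartDomain e then f ⟨y, h⟩ else 0) (e.symm (e x)) :=
    contMDiffAt_of_smoothFun f (fun y => dif_pos y.2) (e.map_target (e.map_source hx))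
  have h2 := h1.comp (e x) (contMDiffAt_symm_of_mem_maximalAtlas he (e.map_source hx))
  exact (contMDiffAt_iff_contDiffAt.1 h2).differentiableAt (by simp)

/-- The differential of a function of the coordinates of one block commutes with an operator that
is a multiple of the identity on that block. -/
lemma chartDiff_comp_of_diagonal
    (he : e ∈ IsManifold.maximalAtlas 𝓘(ℝ, Model n) ∞ M) (f : SmoothFun n (chartDomain e))
    (S : Set (Fin n)) (hf : ∀ x y : chartDomain e,
      (∀ i ∈ S, e (x : M) i = e (y : M) i) → f x = f y)
    (x : chartDomain e) (c : ℝ) (v w : Tan n (x : M))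
    (hvw : ∀ i ∈ S, coordForm e i (x : M) w = c * coordForm e i (x : M) v) :
    chartDiff e f x w = c * chartDiff e f x v := by
  have hx : (x : M) ∈ e.source := x.2
  -- Along the line through `e x` in direction `j` the coordinates in `S` are fixed, so `f` is
  -- constant while the line stays in the target.
  have hzero : ∀ j ∉ S, fderiv ℝ (chartFun e f) (e x) (EuclideanSpace.single j (1 : ℝ)) = 0 := by
    intro j hj
    have hline : HasDerivAt (fun t : ℝ => e x + t • (EuclideanSpace.single j (1 : ℝ) : Model n))
        (EuclideanSpace.single j (1 : ℝ)) 0 := by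
      simpa using ((hasDerivAt_id (0 : ℝ)).smul_const
        (EuclideanSpace.single j (1 : ℝ) : Model n)).const_add (e x)
    have hd : HasFDerivAt (chartFun e f) (fderiv ℝ (chartFun e f) (e x))
        (e x + (0 : ℝ) • (EuclideanSpace.single j (1 : ℝ) : Model n)) := by
      rw [zero_smul, add_zero]
      exact (differentiableAt_chartFun he f hx).hasFDerivAt
    have h1 := hd.comp_hasDerivAt (0 : ℝ) hline
    have h2 : (chartFun e f ∘ fun t : ℝ =>
        e x + t • (EuclideanSpace.single j (1 : ℝ) : Model n)) =ᶠ[𝓝 0] fun _ => f x := by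
      have hcont := hline.continuousAt
      have hmem : ∀ᶠ t : ℝ in 𝓝 0,
          e x + t • (EuclideanSpace.single j (1 : ℝ) : Model n) ∈ e.target := by
        refine hcont.eventually (e.open_target.mem_nhds ?_)
        simp only [zero_smul, add_zero]
        exact e.map_source hx
      filter_upwards [hmem] with t ht
      rw [Function.comp_apply, chartFun_apply f ht]
      refine hf _ _ fun i hi => ?_
      rw [e.right_inv ht]
      have hij : i ≠ j := fun h => hj (h ▸ hi)
      simp [hij]
    exact (h1.congr_of_eventuallyEq h2.symm).unique (hasDerivAt_const 0 (f x))
  have key : ∀ u : Model n, fderiv ℝ (chartFun e f) (e x) u =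
      ∑ i, u i * fderiv ℝ (chartFun e f) (e x) (EuclideanSpace.single i (1 : ℝ)) := by
    intro u
    have hu : u = ∑ i, u i • (EuclideanSpace.single i (1 : ℝ) : Model n) := by
      ext j
      simp [Pi.single_apply]
    conv_lhs => rw [hu]
    rw [map_sum]
    exact Finset.sum_congr rfl fun i _ => map_smul _ _ _
  refine (key _).trans ?_
  rw [show chartDiff e f x v = _ from key _, Finset.mul_sum]
  refine Finset.sum_congr rfl fun i _ => ?_
  by_cases hi : i ∈ S
  · rw [← mul_assoc]
    exact congrArg (· * _) (hvw i hi)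
  · rw [hzero i hi, mul_zero, mul_zero, mul_zero]

variable [IsManifold 𝓘(ℝ, Model n) ∞ M]

lemma SmoothVectorFieldOn.smoothVectorFieldAt {U : Opens M} {X : (x : M) → Tan n x}
    (hX : SmoothVectorFieldOn n (U : Set M) X) {x : M} (hx : x ∈ U) : SmoothVectorFieldAt X x :=
  hX.contMDiffAt (U.isOpen.mem_nhds hx)

lemma OpField.IsSmooth.apply_vectorField {U : Opens M} {L : OpField n U} (hL : L.IsSmooth)
    {X : (x : M) → Tan n x} {x : M} (hx : x ∈ U) (hX : SmoothVectorFieldAt X x) :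
    SmoothVectorFieldAt (fun y => L.ext y (X y)) x :=
  ContMDiffAt.clm_bundle_apply (ContMDiffOn.contMDiffAt hL (U.isOpen.mem_nhds hx)) hX

/-- The Nijenhuis torsion of an operator that is diagonal in the natural frame of a chart. -/
lemma coordForm_nijenhuisTorsion
    (he : e ∈ IsManifold.maximalAtlas 𝓘(ℝ, Model n) ∞ M) {L : OpField n (chartDomain e)}
    (hL : L.IsSmooth) {μ : Fin n → SmoothFun n (chartDomain e)}
    (hμ : ∀ (x : chartDomain e) (w : Tan n (x : M)) (i : Fin n),
      coordForm e i (x : M) (L x w) = μ i x * coordForm e i (x : M) w)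
    (x : chartDomain e) {X Y : (x : M) → Tan n x} (hX : SmoothVectorFieldAt X (x : M))
    (hY : SmoothVectorFieldAt Y (x : M)) (i : Fin n) :
    coordForm e i (x : M) (nijenhuisTorsion n L.ext X Y x) =
      coordForm e i (x : M) (Y x) *
          (chartDiff e (μ i) x (L x (X x)) - μ i x * chartDiff e (μ i) x (X x)) -
        coordForm e i (x : M) (X x) *
          (chartDiff e (μ i) x (L x (Y x)) - μ i x * chartDiff e (μ i) x (Y x)) := by
  have hx : (x : M) ∈ e.source := x.2
  have hext : L.ext (x : M) = L x := L.ext_apply x.2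
  have hLX := hL.apply_vectorField x.2 hX
  have hLY := hL.apply_vectorField x.2 hY
  have hself : ∀ Z : (x : M) → Tan n x, chartField e Z (e x) =
      (mfderiv 𝓘(ℝ, Model n) 𝓘(ℝ, Model n) e (x : M) : Tan n (x : M) →L[ℝ] Model n) (Z x) := by
    intro Z
    refine PiLp.ext fun j => ?_
    rw [chartField_apply he Z (e.map_source hx), e.left_inv hx]
    rfl
  -- Leibniz rule for the component `μ i * Z^i` of `LZ`. In the torsion the terms differentiating
  -- `X` and `Y` cancel; only those differentiating `μ i` survive.
  have hfd : ∀ {Z : (x : M) → Tan n x}, SmoothVectorFieldAt Z (x : M) → ∀ u : Tan n (x : M),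
      fderiv ℝ (fun q => chartField e (fun y => L.ext y (Z y)) q i) (e x)
          ((mfderiv 𝓘(ℝ, Model n) 𝓘(ℝ, Model n) e (x : M) : Tan n (x : M) →L[ℝ] Model n) u) =
        μ i x * fderiv ℝ (fun q => chartField e Z q i) (e x)
          ((mfderiv 𝓘(ℝ, Model n) 𝓘(ℝ, Model n) e (x : M) : Tan n (x : M) →L[ℝ] Model n) u) +
          coordForm e i (x : M) (Z x) * chartDiff e (μ i) x u := by
    intro Z hZ u
    have h1 : (fun q => chartField e (fun y => L.ext y (Z y)) q i) =ᶠ[𝓝 (e x)]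
        fun q => chartFun e (μ i) q * chartField e Z q i := by
      filter_upwards [e.open_target.mem_nhds (e.map_source hx)] with q hq
      rw [chartField_apply he _ hq, chartField_apply he _ hq, chartFun_apply _ hq,
        L.ext_apply (e.map_target hq)]
      exact hμ ⟨_, e.map_target hq⟩ _ i
    have h2 : DifferentiableAt ℝ (fun q => chartField e Z q i) (e x) :=
      (EuclideanSpace.proj i : Model n →L[ℝ] ℝ).differentiableAt.comp (e x)
        (differentiableAt_chartField he hx hZ)
    rw [h1.fderiv_eq, fderiv_fun_mul (differentiableAt_chartFun he _ hx) h2, chartFun_self,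
      chartField_apply he _ (e.map_source hx), e.left_inv hx]
    rfl
  rw [nijenhuisTorsion, hext, map_sub, map_add, hμ, hμ, hμ, map_add,
    coordForm_mlieBracket he hx hX hY, coordForm_mlieBracket he hx hLX hLY,
    coordForm_mlieBracket he hx hX hLY, coordForm_mlieBracket he hx hLX hY]
  simp only [hself, hext]
  erw [hfd hX, hfd hX, hfd hY, hfd hY]
  ring

/-- Component `i` of the Nijenhuis torsion is `Y^i φ(X) - X^i φ(Y)` with `φ` linear. Replacing `Y`
by `LY` multiplies `Y^i` by `μ i`, so in the Haantjes torsion the terms in `Y^i` cancel, and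
likewise those in `X^i`. No condition on the `μ i` is needed. -/
lemma isHaantjes_of_diagonal
    (he : e ∈ IsManifold.maximalAtlas 𝓘(ℝ, Model n) ∞ M) {L : OpField n (chartDomain e)}
    (hL : L.IsSmooth) {μ : Fin n → SmoothFun n (chartDomain e)}
    (hμ : ∀ (x : chartDomain e) (w : Tan n (x : M)) (i : Fin n),
      coordForm e i (x : M) (L x w) = μ i x * coordForm e i (x : M) w) :
    L.IsHaantjes := by
  intro X Y hX hY y hy
  obtain ⟨x, rfl⟩ : ∃ x : chartDomain e, (x : M) = y := ⟨⟨y, hy⟩, rfl⟩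
  have hX := hX.smoothVectorFieldAt hy
  have hY := hY.smoothVectorFieldAt hy
  have hLX := hL.apply_vectorField hy hX
  have hLY := hL.apply_vectorField hy hY
  have hext : L.ext (x : M) = L x := L.ext_apply x.2
  refine eq_of_coordForm_eq he x.2 fun i => ?_
  rw [haantjesTorsion, hext, map_zero, map_sub, map_add, hμ, hμ, hμ, map_add,
    coordForm_nijenhuisTorsion he hL hμ x hX hY, coordForm_nijenhuisTorsion he hL hμ x hLX hLY,
    coordForm_nijenhuisTorsion he hL hμ x hX hLY, coordForm_nijenhuisTorsion he hL hμ x hLX hY]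
  simp only [hext, hμ]
  ring

lemma isNijenhuis_of_diagonal
    (he : e ∈ IsManifold.maximalAtlas 𝓘(ℝ, Model n) ∞ M) {L : OpField n (chartDomain e)}
    (hL : L.IsSmooth) {μ : Fin n → SmoothFun n (chartDomain e)}
    (hμ : ∀ (x : chartDomain e) (w : Tan n (x : M)) (i : Fin n),
      coordForm e i (x : M) (L x w) = μ i x * coordForm e i (x : M) w)
    (hd : ∀ (x : chartDomain e) (w : Tan n (x : M)) (i : Fin n),
      chartDiff e (μ i) x (L x w) = μ i x * chartDiff e (μ i) x w) :
    L.IsNijenhuis := by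
  intro X Y hX hY y hy
  obtain ⟨x, rfl⟩ : ∃ x : chartDomain e, (x : M) = y := ⟨⟨y, hy⟩, rfl⟩
  refine eq_of_coordForm_eq he x.2 fun i => ?_
  rw [coordForm_nijenhuisTorsion he hL hμ x (hX.smoothVectorFieldAt hy)
    (hY.smoothVectorFieldAt hy), hd, hd, map_zero]
  ring

end Torsion

/-! ### Restriction to a chart and matching of blocks with addends -/

section Cyclic

variable {n : ℕ} {M : Type*} [TopologicalSpace M] [ChartedSpace (Model n) M]

lemma adjoin_range_eq_of_spanning {ι : Type*} [Fintype ι] {U : Opens M}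
    {H : Subalgebra (SmoothFun n U) (OpField n U)} {π : ι → OpField n U} (hπH : ∀ i, π i ∈ H)
    (hspan : ∀ F ∈ H, ∃ f : ι → SmoothFun n U, F = ∑ i, f i • π i) :
    H = Algebra.adjoin (SmoothFun n U) (Set.range π) := by
  refine le_antisymm (fun F hF => ?_) (Algebra.adjoin_le ?_)
  · obtain ⟨f, rfl⟩ := hspan F hF
    exact sum_mem fun i _ => Subalgebra.smul_mem _ (Algebra.subset_adjoin (Set.mem_range_self i)) _
  · rintro _ ⟨i, rfl⟩
    exact hπH i

lemma restrictAlgebra_eq_adjoin_range {ι : Type*} [Fintype ι] {U V : Opens M} (h : V ≤ U)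
    {H : Subalgebra (SmoothFun n U) (OpField n U)} {π : ι → OpField n U} (hπH : ∀ i, π i ∈ H)
    (hspan : ∀ F ∈ H, ∃ f : ι → SmoothFun n U, F = ∑ i, f i • π i) :
    restrictAlgebra h H =
      Algebra.adjoin (SmoothFun n V) (Set.range fun i => (π i).res h) := by
  refine le_antisymm (Algebra.adjoin_le ?_) (Algebra.adjoin_mono ?_)
  · rintro _ ⟨F, hF, rfl⟩
    obtain ⟨f, rfl⟩ := hspan F hF
    have : (∑ i, f i • π i).res h = ∑ i, resFun h (f i) • (π i).res h :=
      map_sum (OpField.resHom h) _ _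
    rw [this]
    exact sum_mem fun i _ => Subalgebra.smul_mem _ (Algebra.subset_adjoin (Set.mem_range_self i)) _
  · rintro _ ⟨i, rfl⟩
    exact ⟨π i, hπH i, rfl⟩

lemma eq_of_apply_coordField_eq {e : OpenPartialHomeomorph M (Model n)}
    (he : e ∈ IsManifold.maximalAtlas 𝓘(ℝ, Model n) ∞ M) {x : M} (hx : x ∈ e.source)
    {A B : Tan n x →L[ℝ] Tan n x} (h : ∀ j, A (coordField e j x) = B (coordField e j x)) :
    A = B := by
  ext1 w
  rw [← sum_coordForm_smul_coordField he hx w, map_sum, map_sum]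
  exact Finset.sum_congr rfl fun j _ => by rw [map_smul, map_smul, h]

/-- On the domain of an adapted chart, the blocks of coordinates correspond bijectively to the
addends, and the diagonal operators are the combinations of the projections. -/
lemma exists_equiv_diagonalOperator_eq {ι : Type*} [Fintype ι] [DecidableEq ι] {m : ℕ}
    (hcard : Fintype.card ι = m) {J : ι → (x : M) → Submodule ℝ (Tan n x)}
    {e : OpenPartialHomeomorph M (Model n)} (he : e ∈ IsManifold.maximalAtlas 𝓘(ℝ, Model n) ∞ M)
    {π : ι → OpField n (chartDomain e)} [Nonempty (chartDomain e)] (hπ0 : ∀ i x, π i x ≠ 0)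
    (hπ : ∀ i (x : chartDomain e), ∀ w ∈ J i x, π i x w = w ∧ ∀ j ≠ i, π j x w = 0)
    {b : Fin n → Fin m} (c : Fin m → ι)
    (hc : ∀ a (x : chartDomain e), blockDistribution e b a (x : M) ≤ J (c a) x) :
    Function.Bijective c ∧ ∀ lam : Fin m → SmoothFun n (chartDomain e),
      diagonalOperator e b lam = ∑ a, lam a • π (c a) := by
  have hmem : ∀ (x : chartDomain e) j, coordField e j (x : M) ∈ J (c (b j)) x := fun x j =>
    hc (b j) x (Submodule.subset_span ⟨j, rfl, rfl⟩)
  have hbij : Function.Bijective c := by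
    refine (Fintype.bijective_iff_surjective_and_card c).2 ⟨fun i => ?_, by simp [hcard]⟩
    -- If no block lay in addend `i`, the projection onto it would kill the whole coordinate frame
    -- and vanish. Surjectivity and equal cardinality give bijectivity, so no strict refinement of
    -- the decomposition occurs.
    by_contra! hi
    obtain ⟨x⟩ := ‹Nonempty (chartDomain e)›
    refine hπ0 i x (eq_of_apply_coordField_eq he x.2 fun j => ?_)
    exact (hπ _ x _ (hmem x j)).2 i (hi _).symm
  refine ⟨hbij, fun lam => ?_⟩
  funext x
  refine eq_of_apply_coordField_eq he x.2 fun j => ?_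
  have h1 : (∑ a, lam a • π (c a)) x (coordField e j (x : M)) =
      ∑ a, lam a x • π (c a) x (coordField e j (x : M)) := by
    simp only [OpField.sum_apply, sum_apply]
    rfl
  rw [h1, Finset.sum_eq_single (b j), (hπ _ x _ (hmem x j)).1]
  · refine eq_of_coordForm_eq he x.2 fun k => ?_
    rw [coordForm_diagonalOperator he, map_smul, coordForm_coordField he x.2, smul_eq_mul]
    by_cases hk : k = j
    · rw [hk]
    · rw [if_neg hk, mul_zero, mul_zero]
  · intro a _ ha
    rw [(hπ _ x _ (hmem x j)).2 _ fun h => ha (hbij.1 h), smul_zero]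
  · simp

variable [IsManifold 𝓘(ℝ, Model n) ∞ M]

lemma isCyclicGenerator_of_isEmpty {U : Opens M} [IsEmpty U]
    (H : Subalgebra (SmoothFun n U) (OpField n U)) (m : ℕ) (L : OpField n U) :
    IsCyclicGenerator H m L where
  smooth x hx := isEmptyElim (⟨x, hx⟩ : U)
  haantjes _ _ _ _ x hx := isEmptyElim (⟨x, hx⟩ : U)
  minpoly_degree x := isEmptyElim x
  generates := by
    have := subsingleton_opField (n := n) (U := U)
    exact Subsingleton.elim _ _

end Cyclic

end Haantjes

open Haantjes
theorem proposition5p5 (n m : ℕ) {M : Type*} [TopologicalSpace M] [T2Space M]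
    [ChartedSpace (Model n) M] [IsManifold 𝓘(ℝ, Model n) ∞ M]
    (H : Subalgebra (SmoothFun n (⊤ : Opens M)) (OpField n (⊤ : Opens M)))
    (hH : IsHaantjesAlgebra H m) (hss : IsSemisimpleAlgebra H) (hab : IsAbelianAlgebra H)
    (K : Module.Basis (Fin m) (SmoothFun n (⊤ : Opens M)) H)
    (s : Fin m → ℕ) (l : (k : Fin m) → Fin (s k) → SmoothFun n (⊤ : Opens M))
    (hl : ∀ k, HasDistinctSpectrum (K k : OpField n (⊤ : Opens M)) (l k))
    (hv : numAddends (fun k => (K k : OpField n (⊤ : Opens M))) l ≤ m) :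
    IsCyclicHaantjesAlgebra H m ∧
    ∀ e ∈ IsManifold.maximalAtlas 𝓘(ℝ, Model n) ∞ M, ∀ b : Fin n → Fin m,
      IsAdaptedChart (fun k => (K k : OpField n (⊤ : Opens M))) l e le_top b →
      ∀ lam : Fin m → SmoothFun n (chartDomain e),
        (∀ x, Function.Injective (fun a => lam a x)) →
        IsCyclicGenerator (restrictAlgebra (le_top : chartDomain e ≤ ⊤) H) m
          (diagonalOperator e b lam) ∧
        ((∀ a, ∀ x y : chartDomain e,
            (∀ i, b i = a → e (x : M) i = e (y : M) i) → lam a x = lam a y) →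
          (diagonalOperator e b lam).IsNijenhuis) := by
  classical
  -- The rank comparison needs a point; on an empty manifold every claim is vacuous or an equality
  -- in a trivial algebra.
  rcases isEmpty_or_nonempty (⊤ : Opens M) with hM | hM
  · refine ⟨⟨0, isCyclicGenerator_of_isEmpty _ _ _⟩, fun e _ b _ lam _ => ?_⟩
    have : IsEmpty (chartDomain e) := ⟨fun x => hM.false ⟨x, trivial⟩⟩
    exact ⟨isCyclicGenerator_of_isEmpty _ _ _,
      fun _ _ _ _ _ x hx => isEmptyElim (⟨x, hx⟩ : chartDomain e)⟩
  obtain ⟨π, hπ, hπH, hspan, hcard, hπ0, hJ⟩ :=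
    exists_complete_projections hH.smooth hss hab K hl hv
  constructor
  -- Distinct constants suffice; the combination lies in `H`, so it inherits smoothness and the
  -- Haantjes property.
  · let μ : AddendIndex (fun k => (K k : OpField n (⊤ : Opens M))) l →
      SmoothFun n (⊤ : Opens M) := fun i =>
        ContMDiffMap.const ((Fintype.equivFin _ i : ℕ) : ℝ)
    have hμ : ∀ x, Function.Injective fun i => μ i x := fun x i j hij =>
      (Fintype.equivFin _).injective (Fin.ext (Nat.cast_injective hij))
    have hmem : ∑ i, μ i • π i ∈ H := sum_mem fun i _ => H.smul_mem (hπH i) _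
    have := isCyclicGenerator_sum hπ hπ0 (adjoin_range_eq_of_spanning hπH hspan) μ hμ
      (hH.smooth _ hmem) (hH.haantjes _ hmem)
    rw [hcard] at this
    exact ⟨_, this⟩
  · intro e he b hb lam hlam
    rcases isEmpty_or_nonempty (chartDomain e) with hU | hU
    · exact ⟨isCyclicGenerator_of_isEmpty _ _ _,
        fun _ _ _ _ _ x hx => isEmptyElim (⟨x, hx⟩ : chartDomain e)⟩
    obtain ⟨hsurj, hblock⟩ := hb
    choose c₀ hc₀ using hblock
    -- A block is nonempty and its coordinate fields do not vanish, so the addend containing it is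
    -- one of those counted.
    have hc₁ : ∀ a, ∃ x, jointAddend (fun k => (K k : OpField n (⊤ : Opens M))) l (c₀ a) x ≠ ⊥ := by
      intro a
      obtain ⟨x⟩ := id hU
      obtain ⟨i, hi⟩ := hsurj a
      have hmem : coordField e i (x : M) ∈ jointAddend _ l (c₀ a) ⟨x, trivial⟩ :=
        hc₀ a x (Submodule.subset_span ⟨i, hi, rfl⟩)
      refine ⟨⟨x, trivial⟩, fun h => ?_⟩
      rw [h, Submodule.mem_bot] at hmem
      have h1 := coordForm_coordField he x.2 i i
      rw [hmem, map_zero, if_pos rfl] at h1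
      exact zero_ne_one h1
    let c : Fin m → AddendIndex (fun k => (K k : OpField n (⊤ : Opens M))) l :=
      fun a => ⟨c₀ a, hc₁ a⟩
    have hle : chartDomain e ≤ ⊤ := le_top
    obtain ⟨hbij, hdiag⟩ := exists_equiv_diagonalOperator_eq hcard
      (J := fun i x => jointAddend (fun k => (K k : OpField n (⊤ : Opens M))) l i ⟨x, trivial⟩)
      he (π := fun i => (π i).res hle) (fun i x => hπ0 i ⟨x, trivial⟩)
      (fun i x w hw => hJ i ⟨x, trivial⟩ w hw) c hc₀
    have hL : (diagonalOperator e b lam).IsSmooth := by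
      rw [hdiag]
      exact isSmooth_sum _ fun a _ => isSmooth_smul _ (isSmooth_res hle (hH.smooth _ (hπH _)))
    have hcoord : ∀ (x : chartDomain e) (w : Tan n (x : M)) (i : Fin n),
        coordForm e i (x : M) (diagonalOperator e b lam x w) =
          lam (b i) x * coordForm e i (x : M) w :=
      fun x w i => coordForm_diagonalOperator he b lam x w i
    have hha := isHaantjes_of_diagonal he hL (μ := fun i => lam (b i)) hcoord
    refine ⟨?_, fun hdep => isNijenhuis_of_diagonal he hL (μ := fun i => lam (b i)) hcoord
      fun x w i => chartDiff_comp_of_diagonal he _ {j | b j = b i} (hdep (b i)) x _ w _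
        fun j hj => ?_⟩
    · let σ := Equiv.ofBijective c hbij
      have hres : CompleteOrthogonalIdempotents fun a => (π (c a)).res hle :=
        ((CompleteOrthogonalIdempotents.equiv σ).2 hπ).map (OpField.resHom hle)
      have halg := restrictAlgebra_eq_adjoin_range hle hπH hspan
      rw [← hbij.2.range_comp] at halg
      have := isCyclicGenerator_sum hres (fun a x => hπ0 (c a) ⟨x, trivial⟩) halg lam hlam
        (hdiag lam ▸ hL) (hdiag lam ▸ hha)
      rw [Fintype.card_fin, ← hdiag lam] at this
      exact this
    · have hj : b j = b i := hj
      rw [hcoord, hj]
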